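/- Let $f(x)=1+x+x^2$ over $\mathbb{F}_2=\mathbb{Z}/2$. For $k\ge 0$, row $k$ is the string of coefficients of $f(x)^k$ (reduced modulo $2$) in $x^0,x^1,\dots,x^{\deg f^k}$, in this order. An $m$-block is a string of $m$ digits in $\{0,1\}$; it is accessible if it occurs as a string of $m$ consecutive entries of row $k$ for some $k\ge 0$. Let $a(m)$ be the number of accessible $m$-blocks (so $a(0)=1$). Theorem. For every fixed real $x\in[\tfrac12,1]$, with $n=n_k=\lfloor 2^k/x\rfloor$, $$\lim_{k\to\infty}\frac{a(n_k)}{n_k^2}=\begin{cases}\dfrac54+\dfrac12x-\dfrac5{12}x^2,&\tfrac12\le x\le\tfrac23,\\[1ex]\dfrac32-\dfrac14x+\dfrac7{48}x^2,&\tfrac23\le x\le1.\end{cases}$$ Furthermore, over all positive integers $n$, $$\limsup_{n\to\infty}\frac{a(n)}{n^2}=\frac75,\qquad \liminf_{n\to\infty}\frac{a(n)}{n^2}=\frac{39}{28}.$$ -/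

import Mathlib

open Polynomial Filter Topology

/-- The `m`-block `w` (a string of `m` digits mod `p`) is accessible for `f`: it is a string of
`m` consecutive entries of some row `k`, the row being the list of the coefficients of
`x ^ 0, …, x ^ (deg (f ^ k))` in `f ^ k`. -/
def IsAccessibleBlock {p : ℕ} (f : (ZMod p)[X]) {m : ℕ} (w : Fin m → ZMod p) : Prop :=
  ∃ k i : ℕ, i + m ≤ (f ^ k).natDegree + 1 ∧ ∀ j : Fin m, w j = (f ^ k).coeff (i + j)

/-- The number of accessible `m`-blocks for `f` and `p`. -/
noncomputable def accessibleBlockCount {p : ℕ} (f : (ZMod p)[X]) (m : ℕ) : ℕ :=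
  {w : Fin m → ZMod p | IsAccessibleBlock f w}.ncard

/-!
Over `𝔽₂` one has `f (x) ^ (2 k) = f (x²) ^ k`, so row `2 k` is row `k` interleaved with zeros, and
row `2 k + 1` interleaves row `k` with the sums of its neighbouring entries. It does not matter
whether the rows are padded by zeros: row `k + 2 ^ t` contains a copy of row `k` surrounded by zeros
(`isAccessibleBlock_iff`). Hence the set of all windows into the padded rows is the union of its
images under four substitutions (`rowWindows_eq_union`), one for each choice of the parity of the
row and of the starting point. A block of length `n` in the image of a substitution determines, and
is determined by, a block of about half the length, so the four classes are counted by `a (m)` at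
four arguments `m` near `n / 2`.

The overlaps of the classes have constant size for `n ≥ 6`: the even-row classes share only the zero
block, the odd-row classes share the four blocks satisfying `p (j + 2) = p j + p (j + 1)`, and
an even-row class meets an odd-row class only in `0…0`, `10…0`, `0…01` (`spread_inter_mix`). That
nothing else lies in the last intersection rests on the absence of `1111` and of `1 0…0 1` with a
positive even number of zeros. Inclusion–exclusion gives `blockCount_recursion`:
`a (n) + 8 = a (⌈n/2⌉) + a (⌊n/2⌋) + a (⌈n/2⌉ + 1) + a (⌊n/2⌋ + 1)`.

By this recursion the second difference of `a` vanishes at even places, and at odd places it is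
constant on each half of a dyadic interval: 6 on the first half and 5 on the second
(`countDiff_jump_eq`). Summing twice gives, for `H = 2 ^ t` and up to an error linear in `n`,
`a (n) ≈ 3/2 n² - H n + 7/3 H²` for `4 H ≤ n ≤ 6 H` and `a (n) ≈ 5/4 n² + 2 H n - 20/3 H²` for
`6 H ≤ n ≤ 8 H`. Substituting `4 H / n → x` yields the limits; the upper and lower limits are the
maximum and minimum of these quadratics in `x`, attained at `x = 3/5` and `x = 6/7`.
-/

/-! ### Zero-padded rows -/

/-- Row `k`, the coefficients of `(1 + x + x²) ^ k` mod 2, padded by zeros to a function on `ℤ`. It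
is defined by the local rule, which makes small rows computable. -/
def row : ℕ → ℤ → ZMod 2
  | 0, z => if z = 0 then 1 else 0
  | k + 1, z => row k z + row k (z - 1) + row k (z - 2)

lemma row_eq_zero_of_neg (k : ℕ) : ∀ z : ℤ, z < 0 → row k z = 0 := by
  induction k with
  | zero => intro z hz; simp [row, hz.ne]
  | succ k ih =>
    intro z hz
    rw [row, ih z hz, ih _ (by omega), ih _ (by omega)]; simp

lemma row_eq_zero_of_lt (k : ℕ) : ∀ z : ℤ, 2 * (k : ℤ) < z → row k z = 0 := by
  induction k with
  | zero => intro z hz; simp only [row]; rw [if_neg (by simp at hz; omega)]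
  | succ k ih =>
    intro z hz
    push_cast at hz
    rw [row, ih z (by omega), ih _ (by omega), ih _ (by omega)]; simp

lemma coeff_pow_eq_row (k : ℕ) :
    ∀ i : ℕ, ((1 + X + X ^ 2 : (ZMod 2)[X]) ^ k).coeff i = row k i := by
  induction k with
  | zero => intro i; simp [row, coeff_one]
  | succ k ih =>
    intro i
    rw [pow_succ, mul_add, mul_add, mul_one, coeff_add, coeff_add, row, ih]
    congr 1
    · congr 1
      rcases i with _ | i
      · simp [row_eq_zero_of_neg]
      · rw [coeff_mul_X, ih]; congr 1; push_cast; ring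
    · rw [coeff_mul_X_pow']
      split_ifs with h
      · rw [ih]; congr 1; omega
      · rw [row_eq_zero_of_neg _ _ (by omega)]

lemma natDegree_trinomial_pow (k : ℕ) :
    ((1 + X + X ^ 2 : (ZMod 2)[X]) ^ k).natDegree = 2 * k := by
  rw [natDegree_pow, show (1 + X + X ^ 2 : (ZMod 2)[X]).natDegree = 2 by compute_degree!, mul_comm]

/-- `f ^ (2 ^ t) = 1 + x ^ (2 ^ t) + x ^ (2 ^ (t + 1))`, read off on coefficients. -/
lemma row_add_two_pow (t : ℕ) : ∀ (k : ℕ) (z : ℤ),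
    row (k + 2 ^ t) z = row k z + row k (z - 2 ^ t) + row k (z - 2 * 2 ^ t) := by
  induction t with
  | zero => intro k z; simp [row]
  | succ t ih =>
    intro k z
    rw [pow_succ, mul_two, ← add_assoc, ih, ih k z, ih k (z - 2 ^ t), ih k (z - 2 * 2 ^ t)]
    have key : ∀ a b c d e : ZMod 2,
        a + b + c + (b + c + d) + (c + d + e) = a + c + e := by decide
    rw [show z - 2 ^ t - 2 ^ t = z - 2 * 2 ^ t by ring,
      show z - 2 ^ t - 2 * 2 ^ t = z - 3 * 2 ^ t by ring,
      show z - 2 * 2 ^ t - 2 ^ t = z - 3 * 2 ^ t by ring,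
      show z - 2 * 2 ^ t - 2 * 2 ^ t = z - 4 * 2 ^ t by ring, key,
      show z - 2 ^ (t + 1) = z - 2 * 2 ^ t by ring,
      show z - 2 * 2 ^ (t + 1) = z - 4 * 2 ^ t by ring]

lemma row_two_mul (k : ℕ) : ∀ z : ℤ,
    row (2 * k) (2 * z) = row k z ∧ row (2 * k) (2 * z + 1) = 0 := by
  induction k with
  | zero =>
    intro z
    constructor
    · simp [row]
    · simp only [row]; rw [if_neg (by omega)]
  | succ k ih =>
    intro z
    have h := row_add_two_pow 1 (2 * k)
    rw [show 2 * (k + 1) = 2 * k + 2 ^ 1 by ring, h, h,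
      show (2 * z - 2 ^ 1 : ℤ) = 2 * (z - 1) by ring,
      show (2 * z - 2 * 2 ^ 1 : ℤ) = 2 * (z - 2) by ring,
      show (2 * z + 1 - 2 ^ 1 : ℤ) = 2 * (z - 1) + 1 by ring,
      show (2 * z + 1 - 2 * 2 ^ 1 : ℤ) = 2 * (z - 2) + 1 by ring]
    simp [ih, row]

lemma row_two_mul_add_one (k : ℕ) (z : ℤ) :
    row (2 * k + 1) (2 * z) = row k (z - 1) + row k z ∧ row (2 * k + 1) (2 * z + 1) = row k z := by
  rw [row, row, show (2 * z - 1 : ℤ) = 2 * (z - 1) + 1 by ring,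
      show (2 * z - 2 : ℤ) = 2 * (z - 1) by ring,
      show (2 * z + 1 - 1 : ℤ) = 2 * z by ring,
      show (2 * z + 1 - 2 : ℤ) = 2 * (z - 1) + 1 by ring]
  simp only [(row_two_mul k _).1, (row_two_mul k _).2, add_zero, zero_add, and_true]
  exact add_comm _ _

/-! ### Windows into the rows -/

/-- The one-sided infinite windows into the padded rows. -/
def rowWindows : Set (ℕ → ZMod 2) :=
  {g | ∃ (k : ℕ) (z : ℤ), g = fun j : ℕ => row k (z + j)}

/-- The first `n` digits of an infinite window. -/
def prefixBlock (n : ℕ) (g : ℕ → ZMod 2) : Fin n → ZMod 2 := fun j => g j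

lemma prefixBlock_eq_iff {n : ℕ} {g h : ℕ → ZMod 2} :
    prefixBlock n g = prefixBlock n h ↔ ∀ j < n, g j = h j := by
  simp only [prefixBlock, funext_iff]
  exact ⟨fun H j hj => H ⟨j, hj⟩, fun H j => H j j.2⟩

/-- The number of `n`-blocks of the padded rows. -/
noncomputable def blockCount (n : ℕ) : ℕ := (prefixBlock n '' rowWindows).ncard

/-- Padding creates no new blocks: row `k + 2 ^ t` with `t` large contains a copy of row `k` with
as many zeros as wanted on both sides. -/
lemma isAccessibleBlock_iff {m : ℕ} (w : Fin m → ZMod 2) :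
    IsAccessibleBlock (1 + X + X ^ 2 : (ZMod 2)[X]) w ↔ w ∈ prefixBlock m '' rowWindows := by
  constructor
  · rintro ⟨k, i, -, h⟩
    refine ⟨_, ⟨k, i, rfl⟩, ?_⟩
    funext j
    rw [h j, coeff_pow_eq_row]
    simp [prefixBlock]
  · rintro ⟨_, ⟨k, z, rfl⟩, rfl⟩
    obtain ⟨t, ht⟩ : ∃ t : ℕ, z.natAbs + m + 2 * k < 2 ^ t := ⟨_, Nat.lt_two_pow_self⟩
    have ht' : (z.natAbs + m + 2 * k : ℤ) < 2 ^ t := by exact_mod_cast ht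
    have hc : ((2 ^ t : ℕ) : ℤ) = 2 ^ t := by push_cast; rfl
    refine ⟨k + 2 ^ t, (z + 2 ^ t).toNat, ?_, fun j => ?_⟩
    · rw [natDegree_trinomial_pow]
      omega
    · have hj := j.2
      rw [coeff_pow_eq_row, row_add_two_pow,
        row_eq_zero_of_lt k _ (by push_cast; omega), row_eq_zero_of_neg k (_ - 2 * 2 ^ t)
          (by push_cast; omega), zero_add, add_zero, prefixBlock]
      congr 1
      push_cast
      omega

lemma accessibleBlockCount_eq (m : ℕ) :
    accessibleBlockCount (1 + X + X ^ 2 : (ZMod 2)[X]) m = blockCount m := by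
  unfold accessibleBlockCount blockCount
  congr 1
  ext w
  exact isAccessibleBlock_iff w

/-! ### The four substitutions -/

/-- The window `g₀ 0 g₁ 0 …` of an even row. -/
def spreadEven (g : ℕ → ZMod 2) (j : ℕ) : ZMod 2 := if j % 2 = 0 then g (j / 2) else 0

/-- The window `0 g₀ 0 g₁ …` of an even row. -/
def spreadOdd (g : ℕ → ZMod 2) (j : ℕ) : ZMod 2 := if j % 2 = 0 then 0 else g (j / 2)

/-- The window `g₀ + g₁, g₁, g₁ + g₂, g₂, …` of an odd row. -/
def mixSum (g : ℕ → ZMod 2) (j : ℕ) : ZMod 2 :=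
  if j % 2 = 0 then g (j / 2) + g (j / 2 + 1) else g (j / 2 + 1)

/-- The window `g₀, g₀ + g₁, g₁, g₁ + g₂, …` of an odd row. -/
def mixSelf (g : ℕ → ZMod 2) (j : ℕ) : ZMod 2 :=
  if j % 2 = 0 then g (j / 2) else g (j / 2) + g (j / 2 + 1)

section
variable (g : ℕ → ZMod 2) (i : ℕ)

@[simp] lemma spreadEven_even : spreadEven g (2 * i) = g i := by simp [spreadEven]
@[simp] lemma spreadEven_odd : spreadEven g (2 * i + 1) = 0 := by simp [spreadEven]
@[simp] lemma spreadOdd_even : spreadOdd g (2 * i) = 0 := by simp [spreadOdd]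
@[simp] lemma spreadOdd_odd : spreadOdd g (2 * i + 1) = g i := by
  simp [spreadOdd, show (2 * i + 1) / 2 = i by omega]
@[simp] lemma mixSum_even : mixSum g (2 * i) = g i + g (i + 1) := by simp [mixSum]
@[simp] lemma mixSum_odd : mixSum g (2 * i + 1) = g (i + 1) := by
  simp [mixSum, show (2 * i + 1) / 2 = i by omega]
@[simp] lemma mixSelf_even : mixSelf g (2 * i) = g i := by simp [mixSelf]
@[simp] lemma mixSelf_odd : mixSelf g (2 * i + 1) = g i + g (i + 1) := by
  simp [mixSelf, show (2 * i + 1) / 2 = i by omega]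

end

lemma forall_nat_iff_even_odd {p : ℕ → Prop} :
    (∀ j, p j) ↔ ∀ i, p (2 * i) ∧ p (2 * i + 1) := by
  refine ⟨fun h i => ⟨h _, h _⟩, fun h j => ?_⟩
  obtain ⟨i, rfl | rfl⟩ := Nat.even_or_odd' j
  exacts [(h i).1, (h i).2]

/-- The windows into rows are exactly the images of such windows under the four substitutions,
according to the parities of the row number and of the starting point. -/
lemma mem_rowWindows_iff (g : ℕ → ZMod 2) :
    g ∈ rowWindows ↔ ∃ h ∈ rowWindows,
      g = spreadEven h ∨ g = spreadOdd h ∨ g = mixSum h ∨ g = mixSelf h := by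
  have e1 (k : ℕ) (y : ℤ) : (fun j : ℕ => row (2 * k) (2 * y + j)) =
      spreadEven fun j : ℕ => row k (y + j) := by
    rw [funext_iff, forall_nat_iff_even_odd]
    intro i
    have h := row_two_mul k (y + i)
    push_cast
    rw [← add_assoc, ← mul_add, h.1, h.2]
    simp
  have e2 (k : ℕ) (y : ℤ) : (fun j : ℕ => row (2 * k) (2 * y - 1 + j)) =
      spreadOdd fun j : ℕ => row k (y + j) := by
    rw [funext_iff, forall_nat_iff_even_odd]
    intro i
    have h := row_two_mul k (y + i - 1)
    have h' := row_two_mul k (y + i)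
    push_cast
    rw [show (2 * y - 1 + 2 * i : ℤ) = 2 * (y + i - 1) + 1 by ring,
      show (2 * y - 1 + (2 * i + 1) : ℤ) = 2 * (y + i) by ring, h.2, h'.1]
    simp
  have e3 (k : ℕ) (y : ℤ) : (fun j : ℕ => row (2 * k + 1) (2 * y + 2 + j)) =
      mixSum fun j : ℕ => row k (y + j) := by
    rw [funext_iff, forall_nat_iff_even_odd]
    intro i
    have h := row_two_mul_add_one k (y + i + 1)
    push_cast
    rw [show (2 * y + 2 + 2 * i : ℤ) = 2 * (y + i + 1) by ring,
      show (2 * y + 2 + (2 * i + 1) : ℤ) = 2 * (y + i + 1) + 1 by ring, h.1, h.2,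
      add_sub_cancel_right]
    simp [add_assoc]
  have e4 (k : ℕ) (y : ℤ) : (fun j : ℕ => row (2 * k + 1) (2 * y + 1 + j)) =
      mixSelf fun j : ℕ => row k (y + j) := by
    rw [funext_iff, forall_nat_iff_even_odd]
    intro i
    have h := row_two_mul_add_one k (y + i)
    have h' := row_two_mul_add_one k (y + i + 1)
    push_cast
    rw [show (2 * y + 1 + 2 * i : ℤ) = 2 * (y + i) + 1 by ring,
      show (2 * y + 1 + (2 * i + 1) : ℤ) = 2 * (y + i + 1) by ring, h.2, h'.1, add_sub_cancel_right]
    simp [add_assoc]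
  constructor
  · rintro ⟨k, z, rfl⟩
    obtain ⟨k, rfl | rfl⟩ := Nat.even_or_odd' k <;> obtain ⟨y, rfl | rfl⟩ := Int.even_or_odd' z
    · exact ⟨_, ⟨k, y, rfl⟩, .inl (e1 k y)⟩
    · refine ⟨_, ⟨k, y + 1, rfl⟩, .inr (.inl ?_)⟩
      rw [← e2, show 2 * (y + 1) - 1 = 2 * y + 1 by ring]
    · refine ⟨_, ⟨k, y - 1, rfl⟩, .inr (.inr (.inl ?_))⟩
      rw [← e3, show 2 * (y - 1) + 2 = 2 * y by ring]
    · exact ⟨_, ⟨k, y, rfl⟩, .inr (.inr (.inr (e4 k y)))⟩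
  · rintro ⟨_, ⟨k, y, rfl⟩, rfl | rfl | rfl | rfl⟩
    exacts [⟨_, _, (e1 k y).symm⟩, ⟨_, _, (e2 k y).symm⟩, ⟨_, _, (e3 k y).symm⟩,
      ⟨_, _, (e4 k y).symm⟩]

lemma rowWindows_eq_union : rowWindows =
    (spreadEven '' rowWindows ∪ spreadOdd '' rowWindows) ∪
      (mixSum '' rowWindows ∪ mixSelf '' rowWindows) := by
  ext g
  rw [mem_rowWindows_iff]
  simp only [Set.mem_union, Set.mem_image]
  constructor
  · rintro ⟨h, hh, rfl | rfl | rfl | rfl⟩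
    exacts [.inl (.inl ⟨h, hh, rfl⟩), .inl (.inr ⟨h, hh, rfl⟩), .inr (.inl ⟨h, hh, rfl⟩),
      .inr (.inr ⟨h, hh, rfl⟩)]
  · rintro ((⟨h, hh, rfl⟩ | ⟨h, hh, rfl⟩) | (⟨h, hh, rfl⟩ | ⟨h, hh, rfl⟩))
    exacts [⟨h, hh, .inl rfl⟩, ⟨h, hh, .inr (.inl rfl)⟩, ⟨h, hh, .inr (.inr (.inl rfl))⟩,
      ⟨h, hh, .inr (.inr (.inr rfl))⟩]

/-- If the first `n` digits of `F g` and the first `l` digits of `g` determine each other, then `F`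
contributes as many `n`-blocks as there are `l`-blocks. -/
lemma ncard_prefixBlock_image {F : (ℕ → ZMod 2) → ℕ → ZMod 2} {n l : ℕ}
    (hF : ∀ g h, (∀ j < n, F g j = F h j) ↔ ∀ i < l, g i = h i) :
    (prefixBlock n '' (F '' rowWindows)).ncard = blockCount l := by
  have key : ∀ g h, prefixBlock n (F g) = prefixBlock n (F h) ↔
      prefixBlock l g = prefixBlock l h := by
    intro g h; rw [prefixBlock_eq_iff, prefixBlock_eq_iff, hF]
  rw [blockCount]
  symm
  refine Set.ncard_congr (fun w hw => prefixBlock n (F hw.choose)) ?_ ?_ ?_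
  · intro w hw
    exact ⟨_, ⟨_, hw.choose_spec.1, rfl⟩, rfl⟩
  · intro w v hw hv h
    rw [key, hw.choose_spec.2, hv.choose_spec.2] at h
    exact h
  · rintro _ ⟨_, ⟨g, hg, rfl⟩, rfl⟩
    have hw : prefixBlock l g ∈ prefixBlock l '' rowWindows := ⟨g, hg, rfl⟩
    exact ⟨_, hw, (key _ _).2 hw.choose_spec.2⟩

lemma ncard_prefixBlock_spreadEven (n : ℕ) :
    (prefixBlock n '' (spreadEven '' rowWindows)).ncard = blockCount ((n + 1) / 2) := by
  refine ncard_prefixBlock_image fun g h => ⟨fun H i hi => ?_, fun H => ?_⟩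
  · simpa using H (2 * i) (by omega)
  · rw [forall_nat_iff_even_odd]
    intro i
    simp only [spreadEven_even, spreadEven_odd, implies_true, and_true]
    intro hi
    exact H _ (by omega)

lemma ncard_prefixBlock_spreadOdd (n : ℕ) :
    (prefixBlock n '' (spreadOdd '' rowWindows)).ncard = blockCount (n / 2) := by
  refine ncard_prefixBlock_image fun g h => ⟨fun H i hi => ?_, fun H => ?_⟩
  · simpa using H (2 * i + 1) (by omega)
  · rw [forall_nat_iff_even_odd]
    intro i
    simp only [spreadOdd_even, spreadOdd_odd, implies_true, true_and]
    intro hi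
    exact H _ (by omega)

lemma ncard_prefixBlock_mixSum {n : ℕ} (hn : 2 ≤ n) :
    (prefixBlock n '' (mixSum '' rowWindows)).ncard = blockCount ((n + 1) / 2 + 1) := by
  refine ncard_prefixBlock_image fun g h => ⟨fun H => ?_, fun H => ?_⟩
  · have hodd : ∀ i, 2 * i + 1 < n → g (i + 1) = h (i + 1) := fun i hi => by
      simpa using H (2 * i + 1) hi
    have heven : ∀ i, 2 * i < n → g i + g (i + 1) = h i + h (i + 1) := fun i hi => by
      simpa using H (2 * i) hi
    intro i hi
    rcases i with _ | i
    · have h0 := heven 0 (by omega)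
      rw [hodd 0 (by omega)] at h0
      exact add_right_cancel h0
    · by_cases hi' : 2 * i + 1 < n
      · exact hodd i hi'
      · have h0 := heven i (by omega)
        obtain ⟨i, rfl⟩ : ∃ k, i = k + 1 := ⟨i - 1, by omega⟩
        rw [hodd i (by omega)] at h0
        exact add_left_cancel h0
  · rw [forall_nat_iff_even_odd]
    intro i
    simp only [mixSum_even, mixSum_odd]
    refine ⟨fun hi => ?_, fun hi => H _ (by omega)⟩
    rw [H i (by omega), H (i + 1) (by omega)]

lemma ncard_prefixBlock_mixSelf {n : ℕ} (hn : 1 ≤ n) :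
    (prefixBlock n '' (mixSelf '' rowWindows)).ncard = blockCount (n / 2 + 1) := by
  refine ncard_prefixBlock_image fun g h => ⟨fun H => ?_, fun H => ?_⟩
  · have heven : ∀ i, 2 * i < n → g i = h i := fun i hi => by
      simpa using H (2 * i) hi
    have hodd : ∀ i, 2 * i + 1 < n → g i + g (i + 1) = h i + h (i + 1) := fun i hi => by
      simpa using H (2 * i + 1) hi
    intro i hi
    by_cases hi' : 2 * i < n
    · exact heven i hi'
    · obtain ⟨i, rfl⟩ : ∃ k, i = k + 1 := ⟨i - 1, by omega⟩
      have h0 := hodd i (by omega)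
      rw [heven i (by omega)] at h0
      exact add_left_cancel h0
  · rw [forall_nat_iff_even_odd]
    intro i
    simp only [mixSelf_even, mixSelf_odd]
    refine ⟨fun hi => H _ (by omega), fun hi => ?_⟩
    rw [H i (by omega), H (i + 1) (by omega)]

/-! ### Blocks that do and do not occur -/

/-- No row contains `1111`, so a constant stretch of length at least four is zero. -/
lemma eq_zero_of_const {g : ℕ → ZMod 2} (hg : g ∈ rowWindows) {L : ℕ} (hL : 3 ≤ L)
    (h : ∀ i < L, g i + g (i + 1) = 0) : ∀ i ≤ L, g i = 0 := by
  have h0 : g 0 = 0 := by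
    have a0 := h 0 (by omega)
    have a1 := h 1 (by omega)
    have a2 := h 2 (by omega)
    obtain ⟨u, -, rfl | rfl | rfl | rfl⟩ := (mem_rowWindows_iff g).1 hg
    · have e : spreadEven u 1 = 0 := spreadEven_odd u 0
      rw [e] at a0; simpa using a0
    · exact spreadOdd_even u 0
    · have e0 : mixSum u 0 = u 0 + u 1 := mixSum_even u 0
      have e1 : mixSum u 1 = u 1 := mixSum_odd u 0
      have e2 : mixSum u 2 = u 1 + u 2 := mixSum_even u 1
      have e3 : mixSum u 3 = u 2 := mixSum_odd u 1
      simp only [Nat.reduceAdd, e0, e1, e2, e3] at a0 a1 a2 ⊢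
      clear e0 e1 e2 e3
      generalize u 0 = x0 at *
      generalize u 1 = x1 at *
      generalize u 2 = x2 at *
      revert x0 x1 x2; decide
    · have e0 : mixSelf u 0 = u 0 := mixSelf_even u 0
      have e1 : mixSelf u 1 = u 0 + u 1 := mixSelf_odd u 0
      have e2 : mixSelf u 2 = u 1 := mixSelf_even u 1
      have e3 : mixSelf u 3 = u 1 + u 2 := mixSelf_odd u 1
      simp only [Nat.reduceAdd, e0, e1, e2, e3] at a0 a1 a2 ⊢
      clear e0 e1 e2 e3
      generalize u 0 = x0 at *
      generalize u 1 = x1 at *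
      generalize u 2 = x2 at *
      revert x0 x1 x2; decide
  intro i
  induction i with
  | zero => intro _; exact h0
  | succ i ih =>
    intro hi
    have := h i (by omega)
    rwa [ih (by omega), zero_add] at this

/-- No row contains two ones separated by a positive even number of zeros. -/
lemma not_even_gap {g : ℕ → ZMod 2} (hg : g ∈ rowWindows) {k : ℕ} (hk : 1 ≤ k) (h0 : g 0 ≠ 0)
    (h : ∀ j, 1 ≤ j → j ≤ 2 * k → g j = 0) : g (2 * k + 1) = 0 := by
  obtain ⟨u, -, rfl | rfl | rfl | rfl⟩ := (mem_rowWindows_iff g).1 hg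
  · simp
  · exact absurd (spreadOdd_even u 0) h0
  · have e1 := h (2 * k) (by omega) le_rfl
    have e2 := h (2 * (k - 1) + 1) (by omega) (by omega)
    rw [mixSum_even] at e1
    rw [mixSum_odd, Nat.sub_add_cancel hk] at e2
    rw [mixSum_odd]
    rwa [e2, zero_add] at e1
  · have e1 := h 1 le_rfl (by omega)
    have e2 := h 2 (by omega) (by omega)
    have d1 : mixSelf u 1 = u 0 + u 1 := mixSelf_odd u 0
    have d2 : mixSelf u 2 = u 1 := mixSelf_even u 1
    rw [d2] at e2
    rw [d1, e2, add_zero] at e1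
    exact absurd ((mixSelf_even u 0).trans e1) h0

lemma zero_mem_rowWindows : (fun _ => 0 : ℕ → ZMod 2) ∈ rowWindows := by
  refine ⟨0, 1, ?_⟩
  funext j
  rw [row_eq_zero_of_lt _ _ (by push_cast; omega)]

/-- The window with a single one, at place `a`. -/
def unitAt (a j : ℕ) : ZMod 2 := if j = a then 1 else 0

lemma unitAt_mem_rowWindows (a : ℕ) : unitAt a ∈ rowWindows := by
  refine ⟨0, -a, ?_⟩
  funext j
  simp only [row, unitAt]
  congr 1
  simp only [eq_iff_iff]
  omega

/-- The solutions of `p (j + 2) = p j + p (j + 1)` over `𝔽₂`; they have period 3. -/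
def IsPeriodic (p : ℕ → ZMod 2) : Prop := ∀ j, p (j + 2) = p j + p (j + 1)

lemma IsPeriodic.add_three {p : ℕ → ZMod 2} (hp : IsPeriodic p) (j : ℕ) : p (j + 3) = p j := by
  have h1 := hp j
  have h2 := hp (j + 1)
  simp only [add_assoc, Nat.reduceAdd] at h1 h2
  rw [h2, h1]
  generalize p j = x
  generalize p (j + 1) = y
  revert x y; decide

lemma IsPeriodic.comp_double {p : ℕ → ZMod 2} (hp : IsPeriodic p) (c : ℕ) :
    IsPeriodic fun j => p (2 * j + c) := by
  intro j
  have h1 := hp.add_three (2 * j + c + 1)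
  have h2 := hp (2 * j + c)
  simp only
  rw [show 2 * (j + 2) + c = 2 * j + c + 1 + 3 by ring, h1,
    show 2 * (j + 1) + c = 2 * j + c + 2 by ring, h2]
  generalize p (2 * j + c) = x
  generalize p (2 * j + c + 1) = y
  revert x y; decide

/-- Every 3-block occurs in the padded rows `0, …, 3`. -/
lemma exists_row_eq_three : ∀ a b c : ZMod 2, ∃ (k : Fin 4) (z : Fin 9),
    row k ((z : ℕ) - 2) = a ∧ row k ((z : ℕ) - 1) = b ∧ row k (z : ℕ) = c := by
  decide +kernel

/-- The solution of `p (j + 2) = p j + p (j + 1)` with `p 0 = a`, `p 1 = b`. -/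
def periodicSeq (a b : ZMod 2) (j : ℕ) : ZMod 2 :=
  if j % 3 = 0 then a else if j % 3 = 1 then b else a + b

lemma isPeriodic_periodicSeq (a b : ZMod 2) : IsPeriodic (periodicSeq a b) := by
  intro j
  have h : j % 3 = 0 ∨ j % 3 = 1 ∨ j % 3 = 2 := by omega
  rcases h with h | h | h <;> simp only [periodicSeq, Nat.add_mod j, h] <;> revert a b <;> decide

lemma IsPeriodic.eq_of_recurrence {p q : ℕ → ZMod 2} (hp : IsPeriodic p) {n : ℕ}
    (hq : ∀ j, j + 2 < n → q (j + 2) = q j + q (j + 1)) (h0 : p 0 = q 0) (h1 : p 1 = q 1) :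
    ∀ j < n, p j = q j := by
  intro j
  induction j using Nat.twoStepInduction with
  | zero => intro _; exact h0
  | one => intro _; exact h1
  | more j ih1 ih2 =>
    intro hj
    rw [hp, hq j hj, ih1 (by omega), ih2 (by omega)]

lemma ncard_prefixBlock_isPeriodic {n : ℕ} (hn : 2 ≤ n) :
    (prefixBlock n '' {p | IsPeriodic p}).ncard = 4 := by
  have h : prefixBlock n '' {p | IsPeriodic p} =
      (fun ab : ZMod 2 × ZMod 2 => prefixBlock n (periodicSeq ab.1 ab.2)) '' Set.univ := by
    ext w
    constructor
    · rintro ⟨p, hp, rfl⟩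
      refine ⟨(p 0, p 1), trivial, ?_⟩
      simp only
      rw [prefixBlock_eq_iff]
      exact (isPeriodic_periodicSeq _ _).eq_of_recurrence (fun j _ => hp j) rfl rfl
    · rintro ⟨ab, -, rfl⟩
      exact ⟨_, isPeriodic_periodicSeq _ _, rfl⟩
  rw [h, Set.ncard_image_of_injective, Set.ncard_univ, Nat.card_eq_fintype_card]
  · rfl
  · rintro ⟨a, b⟩ ⟨c, d⟩ he
    simp only [prefixBlock_eq_iff] at he
    have h0 := he 0 (by omega)
    have h1 := he 1 (by omega)
    simp only [periodicSeq, Nat.zero_mod, if_true, Nat.one_mod, one_ne_zero,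
      if_false] at h0 h1
    rw [h0, h1]

/-- A periodic sequence `p` is `mixSelf` of the periodic sequence `i ↦ p (2 i)`, so arbitrarily long
stretches of it occur. -/
lemma IsPeriodic.exists_mem_rowWindows (N : ℕ) : ∀ {p : ℕ → ZMod 2}, IsPeriodic p →
    ∃ g ∈ rowWindows, ∀ j < N + 3, g j = p j := by
  induction N with
  | zero =>
    intro p _
    obtain ⟨k, z, h0, h1, h2⟩ := exists_row_eq_three (p 0) (p 1) (p 2)
    refine ⟨_, ⟨k, (z : ℕ) - 2, rfl⟩, fun j hj => ?_⟩
    interval_cases j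
    · simpa using h0
    · rw [← h1]; congr 1; push_cast; ring
    · rw [← h2]; congr 1; push_cast; ring
  | succ N ih =>
    intro p hp
    obtain ⟨g, hg, h⟩ := ih (hp.comp_double 0)
    refine ⟨mixSelf g, (mem_rowWindows_iff _).2 ⟨g, hg, by simp⟩, ?_⟩
    rw [forall_nat_iff_even_odd]
    refine fun i => ⟨fun hi => ?_, fun hi => ?_⟩
    · rw [mixSelf_even, h i (by omega), add_zero]
    · rw [mixSelf_odd, h i (by omega), h (i + 1) (by omega)]
      have h2 := hp (2 * i)
      simp only [add_zero, mul_add, mul_one]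
      rw [h2]
      generalize p (2 * i) = x
      generalize p (2 * i + 1) = y
      revert x y; decide

/-! ### Overlaps of the four classes of blocks -/

lemma spreadEven_inter_spreadOdd (n : ℕ) :
    prefixBlock n '' (spreadEven '' rowWindows) ∩ prefixBlock n '' (spreadOdd '' rowWindows) =
      {prefixBlock n fun _ => 0} := by
  ext w
  constructor
  · rintro ⟨⟨_, ⟨g, hg, rfl⟩, rfl⟩, ⟨_, ⟨h, hh, rfl⟩, he⟩⟩
    rw [prefixBlock_eq_iff] at he
    rw [Set.mem_singleton_iff, prefixBlock_eq_iff, forall_nat_iff_even_odd]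
    refine fun i => ⟨fun hi => ?_, fun _ => by simp⟩
    rw [← he _ hi]; simp
  · rintro rfl
    refine ⟨⟨_, ⟨_, zero_mem_rowWindows, rfl⟩, ?_⟩, ⟨_, ⟨_, zero_mem_rowWindows, rfl⟩, ?_⟩⟩ <;>
    · rw [prefixBlock_eq_iff, forall_nat_iff_even_odd]
      simp

lemma mixSum_inter_mixSelf (n : ℕ) :
    prefixBlock n '' (mixSum '' rowWindows) ∩ prefixBlock n '' (mixSelf '' rowWindows) =
      prefixBlock n '' {p | IsPeriodic p} := by
  ext w
  constructor
  · rintro ⟨⟨_, ⟨g, hg, rfl⟩, rfl⟩, ⟨_, ⟨h, hh, rfl⟩, he⟩⟩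
    rw [prefixBlock_eq_iff] at he
    have hrec : ∀ j, j + 2 < n → mixSum g (j + 2) = mixSum g j + mixSum g (j + 1) := by
      rw [forall_nat_iff_even_odd]
      refine fun i => ⟨fun hi => ?_, fun hi => ?_⟩
      · rw [← he _ hi, ← he (2 * i) (by omega), ← he (2 * i + 1) (by omega),
          show 2 * i + 2 = 2 * (i + 1) by ring, mixSelf_even, mixSelf_even, mixSelf_odd]
        generalize h i = x
        generalize h (i + 1) = y
        revert x y; decide
      · rw [show 2 * i + 1 + 2 = 2 * (i + 1) + 1 by ring,
          show 2 * i + 1 + 1 = 2 * (i + 1) by ring, mixSum_odd, mixSum_odd, mixSum_even]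
        generalize g (i + 1) = x
        generalize g (i + 1 + 1) = y
        revert x y; decide
    refine ⟨periodicSeq (mixSum g 0) (mixSum g 1), isPeriodic_periodicSeq _ _, ?_⟩
    rw [prefixBlock_eq_iff]
    exact (isPeriodic_periodicSeq _ _).eq_of_recurrence hrec rfl rfl
  · rintro ⟨p, hp, rfl⟩
    constructor
    · obtain ⟨g, hg, h⟩ := (hp.comp_double 2).exists_mem_rowWindows n
      refine ⟨_, ⟨g, hg, rfl⟩, ?_⟩
      rw [prefixBlock_eq_iff, forall_nat_iff_even_odd]
      refine fun i => ⟨fun hi => ?_, fun hi => ?_⟩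
      · rw [mixSum_even, h i (by omega), h (i + 1) (by omega)]
        have h1 := hp.add_three (2 * i + 1)
        have h2 := hp (2 * i)
        rw [show 2 * (i + 1) + 2 = 2 * i + 1 + 3 by ring, h1, h2]
        generalize p (2 * i) = x
        generalize p (2 * i + 1) = y
        revert x y; decide
      · rw [mixSum_odd, h (i + 1) (by omega), ← hp.add_three (2 * i + 1)]
        rfl
    · obtain ⟨g, hg, h⟩ := (hp.comp_double 0).exists_mem_rowWindows n
      refine ⟨_, ⟨g, hg, rfl⟩, ?_⟩
      rw [prefixBlock_eq_iff, forall_nat_iff_even_odd]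
      refine fun i => ⟨fun hi => ?_, fun hi => ?_⟩
      · rw [mixSelf_even, h i (by omega), add_zero]
      · rw [mixSelf_odd, h i (by omega), h (i + 1) (by omega)]
        have h2 := hp (2 * i)
        simp only [add_zero, mul_add, mul_one]
        rw [h2]
        generalize p (2 * i) = x
        generalize p (2 * i + 1) = y
        revert x y; decide

/-- The class of the even rows and the class of the odd rows share only the zero block and the
blocks with a single one, at an end. -/
lemma spread_inter_mix {n : ℕ} (hn : 6 ≤ n) :
    (prefixBlock n '' (spreadEven '' rowWindows) ∪ prefixBlock n '' (spreadOdd '' rowWindows)) ∩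
      (prefixBlock n '' (mixSum '' rowWindows) ∪ prefixBlock n '' (mixSelf '' rowWindows)) =
      {prefixBlock n fun _ => 0, prefixBlock n (unitAt 0), prefixBlock n (unitAt (n - 1))} := by
  ext w
  simp only [Set.mem_insert_iff, Set.mem_singleton_iff]
  constructor
  · rintro ⟨⟨_, ⟨g, hg, rfl⟩, rfl⟩ | ⟨_, ⟨g, hg, rfl⟩, rfl⟩,
      ⟨_, ⟨h, hh, rfl⟩, he⟩ | ⟨_, ⟨h, hh, rfl⟩, he⟩⟩
    all_goals
      rw [← he]
      rw [prefixBlock_eq_iff, forall_nat_iff_even_odd] at he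
      simp only [spreadEven_even, spreadEven_odd, spreadOdd_even, spreadOdd_odd, mixSum_even,
        mixSum_odd, mixSelf_even, mixSelf_odd] at he
      simp only [prefixBlock_eq_iff, forall_nat_iff_even_odd (p := fun j => j < n → _),
        mixSum_even, mixSum_odd, mixSelf_even, mixSelf_odd]
    -- `spreadEven g = mixSum h`: only `h 0` and, for odd `n`, the last digit of `h` can be nonzero
    · have hz : ∀ i, 1 ≤ i → i ≤ n / 2 → h i = 0 := fun i h1 h2 => by
        obtain ⟨i, rfl⟩ : ∃ k, i = k + 1 := ⟨i - 1, by omega⟩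
        exact (he i).2 (by omega)
      have hone : ∀ x : ZMod 2, x ≠ 0 → x = 1 := by decide
      obtain ⟨m, rfl | rfl⟩ := Nat.even_or_odd' n
      · have hz' : ∀ i, 1 ≤ i → i ≤ m → h i = 0 := fun i h1 h2 => hz i h1 (by omega)
        by_cases h0 : h 0 = 0
        · refine .inl fun i => ⟨fun hi => ?_, fun hi => hz' _ (by omega) (by omega)⟩
          rw [hz' (i + 1) (by omega) (by omega), add_zero]
          rcases i with _ | i
          exacts [h0, hz' _ (by omega) (by omega)]
        · refine .inr (.inl fun i => ⟨fun hi => ?_, fun hi => ?_⟩)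
          · rw [hz' (i + 1) (by omega) (by omega), add_zero]
            rcases i with _ | i
            exacts [hone _ h0, hz' _ (by omega) (by omega)]
          · exact hz' _ (by omega) (by omega)
      · have hz' : ∀ i, 1 ≤ i → i ≤ m → h i = 0 := fun i h1 h2 => hz i h1 (by omega)
        have hmid : ∀ i, 1 ≤ i → i < m → h i + h (i + 1) = 0 := fun i h1 h2 => by
          rw [hz' i h1 (by omega), hz' (i + 1) (by omega) (by omega), add_zero]
        by_cases h0 : h 0 = 0 <;> by_cases hm : h (m + 1) = 0
        · refine .inl fun i => ⟨fun hi => ?_, fun hi => hz' _ (by omega) (by omega)⟩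
          have e : ∀ i ≤ m + 1, h i = 0 := fun i hi => by
            rcases Nat.eq_zero_or_pos i with rfl | h1
            · exact h0
            · rcases Nat.lt_or_ge m i with h2 | h2
              · rwa [show i = m + 1 by omega]
              · exact hz' i h1 h2
          rw [e i (by omega), e _ (by omega), add_zero]
        · refine .inr (.inr fun i => ⟨fun hi => ?_, fun hi => ?_⟩)
          · rcases Nat.lt_or_ge i m with h2 | h2
            · rw [unitAt, if_neg (by omega), hz' (i + 1) (by omega) (by omega), add_zero]
              rcases i with _ | i
              exacts [h0, hz' _ (by omega) (by omega)]
            · obtain rfl : i = m := by omega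
              rw [unitAt, if_pos (by omega), hz' i (by omega) le_rfl, zero_add, hone _ hm]
          · rw [unitAt, if_neg (by omega), hz' _ (by omega) (by omega)]
        · refine .inr (.inl fun i => ⟨fun hi => ?_, fun hi => ?_⟩)
          · have e : h (i + 1) = 0 := by
              rcases Nat.lt_or_ge i m with h2 | h2
              · exact hz' _ (by omega) (by omega)
              · rwa [show i = m by omega]
            rw [e, add_zero]
            rcases i with _ | i
            exacts [hone _ h0, hz' _ (by omega) (by omega)]
          · exact hz' _ (by omega) (by omega)
        -- both end digits are 1, so `h` or `g` contains an even gap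
        · exfalso
          obtain ⟨k, rfl | rfl⟩ := Nat.even_or_odd' m
          · exact hm (not_even_gap hh (by omega) h0 hz')
          · have hg0 : g 0 ≠ 0 := by
              rw [← (he 0).1 (by omega), hz' 1 le_rfl (by omega), add_zero]; exact h0
            have e := not_even_gap hg (k := k) (by omega) hg0 fun j h1 h2 => by
              rw [← (he j).1 (by omega), hmid j h1 (by omega)]
            rw [← (he _).1 (by omega), hz' (2 * k + 1) (by omega) le_rfl, zero_add] at e
            exact hm e
    -- `spreadEven g = mixSelf h`: `h` is constant
    · left
      have hz := eq_zero_of_const hh (L := n / 2) (by omega) fun i hi => (he i).2 (by omega)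
      refine fun i => ⟨fun hi => hz i (by omega), fun hi => (he i).2 hi⟩
    -- `spreadOdd g = mixSum h`: `h` is constant
    · left
      have hz := eq_zero_of_const hh (L := (n + 1) / 2) (by omega) fun i hi => (he i).1 (by omega)
      refine fun i => ⟨fun hi => (he i).1 hi, fun hi => hz _ (by omega)⟩
    -- `spreadOdd g = mixSelf h`: only the last digit of `h` can be nonzero
    · have hz : ∀ i, i < (n + 1) / 2 → h i = 0 := fun i hi => (he i).1 (by omega)
      by_cases hl : ∀ i, 2 * i + 1 < n → h (i + 1) = 0
      · refine .inl fun i => ⟨fun hi => hz i (by omega), fun hi => ?_⟩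
        rw [hz i (by omega), hl i hi, add_zero]
      · have hone : ∀ x : ZMod 2, x ≠ 0 → x = 1 := by decide
        push Not at hl
        obtain ⟨k, hk, hk1⟩ := hl
        have hk2 : n = 2 * k + 2 := by
          by_contra hne
          exact hk1 (hz _ (by omega))
        subst hk2
        refine .inr (.inr fun i => ⟨fun hi => ?_, fun hi => ?_⟩)
        · rw [unitAt, if_neg (by omega), hz i (by omega)]
        · rw [hz i (by omega), zero_add]
          by_cases hik : i = k
          · rw [hik, hone _ hk1, unitAt, if_pos (by omega)]
          · rw [unitAt, if_neg (by omega), hz _ (by omega)]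
  · have key : ∀ u v : ℕ → ZMod 2, u ∈ rowWindows → v ∈ rowWindows →
        (prefixBlock n (spreadEven u) = w ∨ prefixBlock n (spreadOdd u) = w) →
        (prefixBlock n (mixSum v) = w ∨ prefixBlock n (mixSelf v) = w) →
        w ∈ (prefixBlock n '' (spreadEven '' rowWindows) ∪
            prefixBlock n '' (spreadOdd '' rowWindows)) ∩
          (prefixBlock n '' (mixSum '' rowWindows) ∪
            prefixBlock n '' (mixSelf '' rowWindows)) := by
      rintro u v hu hv h1 h2
      exact ⟨h1.imp (fun e => ⟨_, ⟨u, hu, rfl⟩, e⟩) (fun e => ⟨_, ⟨u, hu, rfl⟩, e⟩),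
        h2.imp (fun e => ⟨_, ⟨v, hv, rfl⟩, e⟩) (fun e => ⟨_, ⟨v, hv, rfl⟩, e⟩)⟩
    rintro (rfl | rfl | rfl)
    · refine key _ _ zero_mem_rowWindows zero_mem_rowWindows (.inl ?_) (.inl ?_) <;>
      · rw [prefixBlock_eq_iff, forall_nat_iff_even_odd]
        simp
    · refine key _ _ (unitAt_mem_rowWindows 0) (unitAt_mem_rowWindows 0) (.inl ?_) (.inl ?_) <;>
      · rw [prefixBlock_eq_iff, forall_nat_iff_even_odd]
        simp [unitAt]
    · obtain ⟨m, rfl | rfl⟩ := Nat.even_or_odd' n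
      · refine key _ _ (unitAt_mem_rowWindows (m - 1)) (unitAt_mem_rowWindows m)
          (.inr ?_) (.inr ?_)
        all_goals
          rw [prefixBlock_eq_iff, forall_nat_iff_even_odd]
          intro i
          simp only [spreadOdd_even, spreadOdd_odd, mixSelf_even, mixSelf_odd, unitAt]
          grind
      · refine key _ _ (unitAt_mem_rowWindows m) (unitAt_mem_rowWindows (m + 1))
          (.inl ?_) (.inl ?_)
        all_goals
          rw [prefixBlock_eq_iff, forall_nat_iff_even_odd]
          intro i
          simp only [spreadEven_even, spreadEven_odd, mixSum_even, mixSum_odd, unitAt]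
          grind

/-- Inclusion–exclusion over the four classes; the overlaps contribute `1 + 4 + 3 = 8`. -/
lemma blockCount_recursion {n : ℕ} (hn : 6 ≤ n) :
    blockCount n + 8 = blockCount ((n + 1) / 2) + blockCount (n / 2) +
      blockCount ((n + 1) / 2 + 1) + blockCount (n / 2 + 1) := by
  have c12 := Set.ncard_union_add_ncard_inter (prefixBlock n '' (spreadEven '' rowWindows))
    (prefixBlock n '' (spreadOdd '' rowWindows)) (Set.toFinite _) (Set.toFinite _)
  have c34 := Set.ncard_union_add_ncard_inter (prefixBlock n '' (mixSum '' rowWindows))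
    (prefixBlock n '' (mixSelf '' rowWindows)) (Set.toFinite _) (Set.toFinite _)
  have c := Set.ncard_union_add_ncard_inter
    (prefixBlock n '' (spreadEven '' rowWindows) ∪ prefixBlock n '' (spreadOdd '' rowWindows))
    (prefixBlock n '' (mixSum '' rowWindows) ∪ prefixBlock n '' (mixSelf '' rowWindows))
    (Set.toFinite _) (Set.toFinite _)
  rw [spread_inter_mix hn, ← Set.image_union, ← Set.image_union, ← Set.image_union,
    ← rowWindows_eq_union, Set.image_union, Set.image_union, ← blockCount] at c
  rw [spreadEven_inter_spreadOdd, Set.ncard_singleton, ncard_prefixBlock_spreadEven,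
    ncard_prefixBlock_spreadOdd] at c12
  rw [mixSum_inter_mixSelf, ncard_prefixBlock_isPeriodic (by omega),
    ncard_prefixBlock_mixSum (by omega), ncard_prefixBlock_mixSelf (by omega)] at c34
  have hcard : ({prefixBlock n fun _ => 0, prefixBlock n (unitAt 0),
      prefixBlock n (unitAt (n - 1))} : Set (Fin n → ZMod 2)).ncard = 3 := by
    rw [Set.ncard_eq_three]
    refine ⟨_, _, _, ?_, ?_, ?_, rfl⟩ <;> rw [Ne, prefixBlock_eq_iff] <;> intro H
    · simpa [unitAt] using H 0 (by omega)
    · simpa [unitAt] using H (n - 1) (by omega)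
    · have := H 0 (by omega)
      rw [unitAt, unitAt, if_pos rfl, if_neg (by omega)] at this
      exact one_ne_zero this
  rw [hcard] at c
  omega

/-! ### Blocks of length three, four and five -/

lemma blockCount_three : blockCount 3 = 8 := by
  have h : prefixBlock 3 '' rowWindows = Set.univ := by
    rw [Set.eq_univ_iff_forall]
    intro w
    obtain ⟨k, z, h0, h1, h2⟩ := exists_row_eq_three (w 0) (w 1) (w 2)
    refine ⟨_, ⟨k, (z : ℕ) - 2, rfl⟩, ?_⟩
    funext j
    fin_cases j
    · simpa [prefixBlock] using h0
    · simp only [prefixBlock]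
      exact Eq.trans (by congr 1; push_cast; ring) h1
    · simp only [prefixBlock]
      exact Eq.trans (by congr 1; push_cast; ring) h2
  rw [blockCount, h, Set.ncard_univ, Nat.card_eq_fintype_card]
  rfl

lemma shift_mem_rowWindows {g : ℕ → ZMod 2} (hg : g ∈ rowWindows) (c : ℕ) :
    (fun j => g (j + c)) ∈ rowWindows := by
  obtain ⟨k, z, rfl⟩ := hg
  refine ⟨k, z + c, ?_⟩
  funext j
  change row k (z + (j + c : ℕ)) = row k (z + c + j)
  congr 1
  push_cast
  ring

/-- The two 4-blocks that do not occur are `1111` and `1001`. -/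
lemma window_four {g : ℕ → ZMod 2} (hg : g ∈ rowWindows) (c : ℕ) :
    ¬ (g c = 1 ∧ g (c + 3) = 1 ∧ g (c + 1) = g (c + 2)) := by
  rintro ⟨h0, h3, h12⟩
  have hs := shift_mem_rowWindows hg c
  have h2 : ∀ x : ZMod 2, x = 0 ∨ x = 1 := by decide
  rcases h2 (g (c + 1)) with h1 | h1
  · have := not_even_gap hs (k := 1) le_rfl (by simp [h0]) fun j hj hj' => by
      interval_cases j
      · rwa [add_comm]
      · rw [add_comm, ← h12, h1]
    rw [add_comm, h3] at this
    exact one_ne_zero this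
  · have := eq_zero_of_const hs (L := 3) le_rfl (fun i hi => by
      interval_cases i
      · rw [zero_add, zero_add, add_comm 1 c, h0, h1]; rfl
      · rw [add_comm 1 c, add_comm _ c, ← h12, h1]; rfl
      · rw [add_comm 2 c, add_comm _ c, ← h12, h1, h3]; rfl) 0 (by omega)
    rw [zero_add, h0] at this
    exact one_ne_zero this

/-- Every 5-block containing neither `1111` nor `1001` occurs in the padded rows `0, …, 5`. -/
lemma exists_row_eq_five : ∀ a b c d e : ZMod 2, ¬ (a = 1 ∧ d = 1 ∧ b = c) →
    ¬ (b = 1 ∧ e = 1 ∧ c = d) → ∃ (k : Fin 6) (z : Fin 11),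
      row k ((z : ℕ) - 5) = a ∧ row k ((z : ℕ) - 4) = b ∧ row k ((z : ℕ) - 3) = c ∧
      row k ((z : ℕ) - 2) = d ∧ row k ((z : ℕ) - 1) = e := by
  decide +kernel

lemma exists_window_five (w : Fin 5 → ZMod 2) (h : ¬ (w 0 = 1 ∧ w 3 = 1 ∧ w 1 = w 2))
    (h' : ¬ (w 1 = 1 ∧ w 4 = 1 ∧ w 2 = w 3)) : ∃ g ∈ rowWindows, prefixBlock 5 g = w := by
  obtain ⟨k, z, h0, h1, h2, h3, h4⟩ := exists_row_eq_five (w 0) (w 1) (w 2) (w 3) (w 4) h h'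
  refine ⟨_, ⟨k, (z : ℕ) - 5, rfl⟩, ?_⟩
  funext j
  simp only [prefixBlock]
  fin_cases j
  · exact Eq.trans (by congr 1; simp) h0
  · exact Eq.trans (by congr 1; push_cast; ring) h1
  · exact Eq.trans (by congr 1; push_cast; ring) h2
  · exact Eq.trans (by congr 1; push_cast; ring) h3
  · exact Eq.trans (by congr 1; push_cast; ring) h4

lemma blockCount_five : blockCount 5 = 25 := by
  have h : prefixBlock 5 '' rowWindows = ↑(Finset.univ.filter fun w : Fin 5 → ZMod 2 =>
      ¬ (w 0 = 1 ∧ w 3 = 1 ∧ w 1 = w 2) ∧ ¬ (w 1 = 1 ∧ w 4 = 1 ∧ w 2 = w 3)) := by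
    ext w
    simp only [Finset.coe_filter, Finset.mem_univ, true_and, Set.mem_ofPred_eq]
    constructor
    · rintro ⟨g, hg, rfl⟩
      exact ⟨window_four hg 0, window_four hg 1⟩
    · rintro ⟨h1, h2⟩
      exact exists_window_five w h1 h2
  rw [blockCount, h, Set.ncard_coe_finset]
  decide +kernel

lemma blockCount_four : blockCount 4 = 14 := by
  have h : prefixBlock 4 '' rowWindows = ↑(Finset.univ.filter fun w : Fin 4 → ZMod 2 =>
      ¬ (w 0 = 1 ∧ w 3 = 1 ∧ w 1 = w 2)) := by
    ext w
    simp only [Finset.coe_filter, Finset.mem_univ, true_and, Set.mem_ofPred_eq]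
    constructor
    · rintro ⟨g, hg, rfl⟩
      exact window_four hg 0
    · intro h1
      obtain ⟨g, hg, h⟩ := exists_window_five ![w 0, w 1, w 2, w 3, 0] h1
        (fun h => zero_ne_one h.2.1)
      refine ⟨g, hg, ?_⟩
      funext j
      have := congrFun h j.castSucc
      fin_cases j <;> exact this
  rw [blockCount, h, Set.ncard_coe_finset]
  decide +kernel

/-! ### Closed form of the counting function -/

/-- The first difference of `blockCount`, as an integer. -/
noncomputable def countDiff (n : ℕ) : ℤ := blockCount (n + 1) - blockCount n

lemma blockCount_two_mul {m : ℕ} (hm : 3 ≤ m) :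
    blockCount (2 * m) + 8 = 2 * blockCount m + 2 * blockCount (m + 1) := by
  rw [blockCount_recursion (by omega), show (2 * m + 1) / 2 = m by omega,
    show 2 * m / 2 = m by omega]
  ring

lemma blockCount_two_mul_add_one {m : ℕ} (hm : 3 ≤ m) :
    blockCount (2 * m + 1) + 8 = blockCount m + 2 * blockCount (m + 1) + blockCount (m + 2) := by
  rw [blockCount_recursion (by omega), show (2 * m + 1 + 1) / 2 = m + 1 by omega,
    show (2 * m + 1) / 2 = m by omega]
  ring

lemma countDiff_two_mul {m : ℕ} (hm : 3 ≤ m) :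
    countDiff (2 * m) = countDiff m + countDiff (m + 1) := by
  have h1 := blockCount_two_mul hm
  have h2 := blockCount_two_mul_add_one hm
  simp only [countDiff, add_assoc, Nat.reduceAdd] at *
  omega

lemma countDiff_two_mul_add_one {m : ℕ} (hm : 3 ≤ m) :
    countDiff (2 * m + 1) = countDiff m + countDiff (m + 1) := by
  have h1 := blockCount_two_mul (m := m + 1) (by omega)
  have h2 := blockCount_two_mul_add_one hm
  simp only [countDiff, mul_add, add_assoc, Nat.reduceAdd, Nat.reduceMul] at *
  omega

lemma blockCount_six : blockCount 6 = 36 := by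
  have := blockCount_two_mul (m := 3) le_rfl
  simp only [Nat.reduceMul, Nat.reduceAdd] at this
  rw [blockCount_three, blockCount_four] at this
  omega

lemma blockCount_seven : blockCount 7 = 53 := by
  have := blockCount_two_mul_add_one (m := 3) le_rfl
  simp only [Nat.reduceMul, Nat.reduceAdd] at this
  rw [blockCount_three, blockCount_four, blockCount_five] at this
  omega

lemma blockCount_eight : blockCount 8 = 70 := by
  have := blockCount_two_mul (m := 4) (by omega)
  simp only [Nat.reduceMul, Nat.reduceAdd] at this
  rw [blockCount_four, blockCount_five] at this
  omega

lemma blockCount_nine : blockCount 9 = 92 := by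
  have := blockCount_two_mul_add_one (m := 4) (by omega)
  simp only [Nat.reduceMul, Nat.reduceAdd] at this
  rw [blockCount_four, blockCount_five, blockCount_six] at this
  omega

lemma countDiff_even {j : ℕ} (hj : 2 ≤ j) : countDiff (2 * j + 1) = countDiff (2 * j) := by
  rcases hj.eq_or_lt with rfl | hj
  · simp only [countDiff, Nat.reduceMul, Nat.reduceAdd]
    rw [blockCount_four, blockCount_five, blockCount_six]
    norm_num
  · rw [countDiff_two_mul hj, countDiff_two_mul_add_one hj]

/-- The jumps of the first difference sit at the odd places, and the jumps at `4 j + 1` and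
`4 j + 3` are both inherited from the one at `2 j + 1`. -/
lemma countDiff_jump {j : ℕ} (hj : 2 ≤ j) {i : ℕ} (hi : i = 2 * j ∨ i = 2 * j + 1) :
    countDiff (2 * i + 2) - countDiff (2 * i + 1) =
      countDiff (2 * j + 2) - countDiff (2 * j + 1) := by
  rw [show 2 * i + 2 = 2 * (i + 1) by ring, countDiff_two_mul (by omega),
    countDiff_two_mul_add_one (by omega)]
  rcases hi with rfl | rfl
  · rw [← countDiff_even hj]; ring
  · have := countDiff_even (j := j + 1) (by omega)
    rw [show 2 * j + 1 + 1 + 1 = 2 * (j + 1) + 1 by ring, this]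
    rw [show 2 * (j + 1) = 2 * j + 1 + 1 by ring]
    ring

lemma countDiff_jump_eq (t : ℕ) : ∀ j,
    (2 * 2 ^ t ≤ j → j < 3 * 2 ^ t → countDiff (2 * j + 2) - countDiff (2 * j + 1) = 6) ∧
    (3 * 2 ^ t ≤ j → j < 4 * 2 ^ t → countDiff (2 * j + 2) - countDiff (2 * j + 1) = 5) := by
  induction t with
  | zero =>
    refine fun j => ⟨fun h1 h2 => ?_, fun h1 h2 => ?_⟩
    · obtain rfl : j = 2 := by omega
      simp only [countDiff, Nat.reduceMul, Nat.reduceAdd]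
      rw [blockCount_five, blockCount_six, blockCount_seven]; norm_num
    · obtain rfl : j = 3 := by omega
      simp only [countDiff, Nat.reduceMul, Nat.reduceAdd]
      rw [blockCount_seven, blockCount_eight, blockCount_nine]; norm_num
  | succ t ih =>
    intro i
    have hp : 1 ≤ 2 ^ t := Nat.one_le_two_pow
    obtain ⟨j, hj⟩ := Nat.even_or_odd' i
    refine ⟨fun h1 h2 => ?_, fun h1 h2 => ?_⟩ <;> rw [pow_succ] at h1 h2 <;>
      rw [countDiff_jump (j := j) (by omega) hj]
    · exact (ih j).1 (by omega) (by omega)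
    · exact (ih j).2 (by omega) (by omega)

lemma countDiff_base (t : ℕ) : countDiff (4 * 2 ^ t + 1) = 11 * 2 ^ t := by
  induction t with
  | zero =>
    simp only [countDiff, pow_zero, mul_one, Nat.reduceAdd]
    rw [blockCount_five, blockCount_six]; norm_num
  | succ t ih =>
    have hp : 1 ≤ 2 ^ t := Nat.one_le_two_pow
    rw [pow_succ, show 4 * (2 ^ t * 2) + 1 = 2 * (4 * 2 ^ t) + 1 by ring,
      countDiff_two_mul_add_one (by omega), show 4 * 2 ^ t = 2 * (2 * 2 ^ t) by ring,
      ← countDiff_even (by omega), show 2 * (2 * 2 ^ t) = 4 * 2 ^ t by ring, ih]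
    ring

lemma blockCount_base (t : ℕ) : (3 * blockCount (4 * 2 ^ t + 1) : ℤ) = 67 * (2 ^ t) ^ 2 + 8 := by
  induction t with
  | zero =>
    simp only [pow_zero, mul_one, Nat.reduceAdd]
    rw [blockCount_five]; norm_num
  | succ t ih =>
    have hp : 1 ≤ 2 ^ t := Nat.one_le_two_pow
    have h1 := blockCount_two_mul_add_one (m := 4 * 2 ^ t) (by omega)
    have h2 := countDiff_even (j := 2 * 2 ^ t) (by omega)
    rw [show 2 * (2 * 2 ^ t) = 4 * 2 ^ t by ring] at h2
    simp only [countDiff, add_assoc, Nat.reduceAdd] at h2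
    rw [show 4 * 2 ^ (t + 1) + 1 = 2 * (4 * 2 ^ t) + 1 by ring]
    zify at h1
    have h3 : ((2 : ℤ) ^ (t + 1)) ^ 2 = 4 * (2 ^ t) ^ 2 := by ring
    rw [h3]
    linarith

/-- Summation of a constant jump `c` of the first difference over the odd places from `N + 1` to
`N + 2 i - 1`. -/
lemma blockCount_sum {N H : ℕ} {c D : ℤ} (hN : 4 ≤ N) (hN2 : Even N) (hD : countDiff (N + 1) = D)
    (hc : ∀ i < H, countDiff (N + 2 * i + 2) - countDiff (N + 2 * i + 1) = c) :
    ∀ i ≤ H, countDiff (N + 2 * i + 1) = D + c * i ∧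
      (blockCount (N + 2 * i + 1) : ℤ) = blockCount (N + 1) + 2 * D * i + c * i ^ 2 := by
  intro i
  induction i with
  | zero => intro _; simp [hD]
  | succ i ih =>
    intro hi
    obtain ⟨h1, h2⟩ := ih (by omega)
    have h3 := hc i (by omega)
    obtain ⟨M, hM⟩ := hN2
    have h4 := countDiff_even (j := M + i + 1) (by omega)
    rw [show 2 * (M + i + 1) = N + 2 * i + 2 by omega] at h4
    rw [show N + 2 * (i + 1) + 1 = N + 2 * i + 2 + 1 by ring, h4]
    push_cast
    refine ⟨by linarith, ?_⟩
    have e1 : countDiff (N + 2 * i + 2) =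
      blockCount (N + 2 * i + 2 + 1) - blockCount (N + 2 * i + 2) := rfl
    have e2 : countDiff (N + 2 * i + 1) =
      blockCount (N + 2 * i + 2) - blockCount (N + 2 * i + 1) := rfl
    linarith

/-- Exact values at the odd places of the first half of a dyadic interval. -/
lemma blockCount_first_half (t : ℕ) : ∀ i ≤ 2 ^ t,
    countDiff (4 * 2 ^ t + 2 * i + 1) = 11 * 2 ^ t + 6 * i ∧
    (3 * blockCount (4 * 2 ^ t + 2 * i + 1) : ℤ) =
      67 * (2 ^ t) ^ 2 + 8 + 66 * 2 ^ t * i + 18 * i ^ 2 := by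
  intro i hi
  have hp : 1 ≤ 2 ^ t := Nat.one_le_two_pow
  have h := blockCount_sum (N := 4 * 2 ^ t) (by omega) ⟨2 * 2 ^ t, by ring⟩ (countDiff_base t)
    (fun i hi => by
      have := (countDiff_jump_eq t (2 * 2 ^ t + i)).1 (by omega) (by omega)
      rwa [show 2 * (2 * 2 ^ t + i) = 4 * 2 ^ t + 2 * i by ring] at this) i hi
  have hb := blockCount_base t
  exact ⟨h.1, by linarith [h.2]⟩

/-- Exact values at the odd places of the second half of a dyadic interval. -/
lemma blockCount_second_half (t : ℕ) : ∀ i ≤ 2 ^ t,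
    countDiff (6 * 2 ^ t + 2 * i + 1) = 17 * 2 ^ t + 5 * i ∧
    (3 * blockCount (6 * 2 ^ t + 2 * i + 1) : ℤ) =
      151 * (2 ^ t) ^ 2 + 8 + 102 * 2 ^ t * i + 15 * i ^ 2 := by
  intro i hi
  have hp : 1 ≤ 2 ^ t := Nat.one_le_two_pow
  have h0 := blockCount_first_half t (2 ^ t) le_rfl
  rw [show 4 * 2 ^ t + 2 * 2 ^ t + 1 = 6 * 2 ^ t + 1 by ring] at h0
  have h := blockCount_sum (N := 6 * 2 ^ t) (by omega) ⟨3 * 2 ^ t, by ring⟩ h0.1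
    (fun i hi => by
      have := (countDiff_jump_eq t (3 * 2 ^ t + i)).2 (by omega) (by omega)
      rwa [show 2 * (3 * 2 ^ t + i) = 6 * 2 ^ t + 2 * i by ring] at this) i hi
  push_cast at h h0
  exact ⟨by linarith [h.1], by linarith [h.2, h0.2]⟩

/-! ### Quadratic approximation -/

/-- In the first half of a dyadic interval, `blockCount` is a quadratic form in `n` and the power
of two, up to a linear error. -/
lemma abs_blockCount_sub_le_first (t n : ℕ) (h1 : 4 * 2 ^ t ≤ n) (h2 : n ≤ 6 * 2 ^ t) :
    |(blockCount n : ℝ) - (3 / 2 * (n : ℝ) ^ 2 - 2 ^ t * n + 7 / 3 * (2 ^ t) ^ 2)| ≤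
      10 * (n : ℝ) := by
  have hp : 1 ≤ 2 ^ t := Nat.one_le_two_pow
  obtain ⟨i, hi⟩ := Nat.even_or_odd' (n - 4 * 2 ^ t)
  have hi' : i ≤ 2 ^ t := by omega
  obtain ⟨d, b⟩ := blockCount_first_half t i hi'
  have b' : (3 * blockCount (4 * 2 ^ t + 2 * i + 1) : ℝ) =
      67 * (2 ^ t) ^ 2 + 8 + 66 * 2 ^ t * i + 18 * i ^ 2 := by exact_mod_cast b
  have hpR : (1 : ℝ) ≤ 2 ^ t := by exact_mod_cast hp
  have hi0 : (0 : ℝ) ≤ i := by positivity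
  rcases hi with hi | hi
  · obtain rfl : n = 4 * 2 ^ t + 2 * i := by omega
    have h3 := countDiff_even (j := 2 * 2 ^ t + i) (by omega)
    rw [show 2 * (2 * 2 ^ t + i) = 4 * 2 ^ t + 2 * i by ring, d, countDiff] at h3
    have h3' : (11 * 2 ^ t + 6 * i : ℝ) = blockCount (4 * 2 ^ t + 2 * i + 1) -
      blockCount (4 * 2 ^ t + 2 * i) := by exact_mod_cast h3
    push_cast
    rw [abs_le]
    constructor <;> linarith
  · obtain rfl : n = 4 * 2 ^ t + 2 * i + 1 := by omega
    push_cast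
    rw [abs_le]
    constructor <;> linarith

/-- The quadratic form for the second half of a dyadic interval. -/
lemma abs_blockCount_sub_le_second (t n : ℕ) (h1 : 6 * 2 ^ t ≤ n) (h2 : n ≤ 8 * 2 ^ t) :
    |(blockCount n : ℝ) - (5 / 4 * (n : ℝ) ^ 2 + 2 * 2 ^ t * n - 20 / 3 * (2 ^ t) ^ 2)| ≤
      10 * (n : ℝ) := by
  have hp : 1 ≤ 2 ^ t := Nat.one_le_two_pow
  obtain ⟨i, hi⟩ := Nat.even_or_odd' (n - 6 * 2 ^ t)
  have hi' : i ≤ 2 ^ t := by omega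
  obtain ⟨d, b⟩ := blockCount_second_half t i hi'
  have b' : (3 * blockCount (6 * 2 ^ t + 2 * i + 1) : ℝ) =
      151 * (2 ^ t) ^ 2 + 8 + 102 * 2 ^ t * i + 15 * i ^ 2 := by exact_mod_cast b
  have hpR : (1 : ℝ) ≤ 2 ^ t := by exact_mod_cast hp
  have hi0 : (0 : ℝ) ≤ i := by positivity
  rcases hi with hi | hi
  · obtain rfl : n = 6 * 2 ^ t + 2 * i := by omega
    have h3 := countDiff_even (j := 3 * 2 ^ t + i) (by omega)
    rw [show 2 * (3 * 2 ^ t + i) = 6 * 2 ^ t + 2 * i by ring, d, countDiff] at h3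
    have h3' : (17 * 2 ^ t + 5 * i : ℝ) = blockCount (6 * 2 ^ t + 2 * i + 1) -
      blockCount (6 * 2 ^ t + 2 * i) := by exact_mod_cast h3
    push_cast
    rw [abs_le]
    constructor <;> linarith
  · obtain rfl : n = 6 * 2 ^ t + 2 * i + 1 := by omega
    push_cast
    rw [abs_le]
    constructor <;> linarith

/-! ### Limits -/

lemma tendsto_pow_div_floor {x : ℝ} (hx : 0 < x) :
    Tendsto (fun k : ℕ => (2 : ℝ) ^ k / (⌊(2 : ℝ) ^ k / x⌋₊ : ℝ)) atTop (𝓝 x) ∧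
    Tendsto (fun k : ℕ => ⌊(2 : ℝ) ^ k / x⌋₊) atTop atTop := by
  have h1 : Tendsto (fun k : ℕ => (2 : ℝ) ^ k / x) atTop atTop :=
    (tendsto_pow_atTop_atTop_of_one_lt one_lt_two).atTop_div_const hx
  refine ⟨?_, tendsto_nat_floor_atTop.comp h1⟩
  have h2 := ((tendsto_nat_floor_div_atTop (R := ℝ)).comp h1).inv₀ one_ne_zero
  have h3 := h2.const_mul x
  rw [inv_one, mul_one] at h3
  refine h3.congr fun k => ?_
  simp only [Function.comp]
  rw [inv_div, ← mul_div_assoc, mul_div_cancel₀ _ hx.ne']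

/-- A quadratic form approximation with linear error gives the limit along `⌊2 ^ k / x⌋`. -/
lemma tendsto_of_quadratic {x a b c : ℝ} (hx : 0 < x)
    (h : ∀ t : ℕ, |(blockCount ⌊(2 : ℝ) ^ (t + 2) / x⌋₊ : ℝ) -
      (a * (⌊(2 : ℝ) ^ (t + 2) / x⌋₊ : ℝ) ^ 2 + b * 2 ^ t * ⌊(2 : ℝ) ^ (t + 2) / x⌋₊ +
        c * (2 ^ t) ^ 2)| ≤ 10 * (⌊(2 : ℝ) ^ (t + 2) / x⌋₊ : ℝ)) :
    Tendsto (fun k : ℕ => (blockCount ⌊(2 : ℝ) ^ k / x⌋₊ : ℝ) / (⌊(2 : ℝ) ^ k / x⌋₊ : ℝ) ^ 2)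
      atTop (𝓝 (a + b * (x / 4) + c * (x / 4) ^ 2)) := by
  rw [← tendsto_add_atTop_iff_nat 2]
  obtain ⟨h1, h2⟩ := tendsto_pow_div_floor hx
  rw [← tendsto_add_atTop_iff_nat 2] at h1 h2
  have h3 := h1.div_const 4
  have h4 := ((h3.const_mul b).const_add a).add ((h3.pow 2).const_mul c)
  have h5 : Tendsto (fun k : ℕ => 10 / (⌊(2 : ℝ) ^ (k + 2) / x⌋₊ : ℝ)) atTop (𝓝 0) :=
    (tendsto_natCast_atTop_atTop.comp h2).const_div_atTop 10
  have h6 := squeeze_zero_norm' (f := fun k : ℕ =>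
    (blockCount ⌊(2 : ℝ) ^ (k + 2) / x⌋₊ : ℝ) / (⌊(2 : ℝ) ^ (k + 2) / x⌋₊ : ℝ) ^ 2 -
      (a + b * ((2 : ℝ) ^ (k + 2) / (⌊(2 : ℝ) ^ (k + 2) / x⌋₊ : ℝ) / 4) +
        c * ((2 : ℝ) ^ (k + 2) / (⌊(2 : ℝ) ^ (k + 2) / x⌋₊ : ℝ) / 4) ^ 2)) ?_ h5
  · have h7 := h6.add h4
    rw [zero_add] at h7
    exact h7.congr fun k => sub_add_cancel _ _
  · filter_upwards [h2.eventually_ge_atTop 1] with k hk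
    have hn : (0 : ℝ) < ⌊(2 : ℝ) ^ (k + 2) / x⌋₊ := by exact_mod_cast hk
    have hb := h k
    generalize (⌊(2 : ℝ) ^ (k + 2) / x⌋₊) = n at *
    rw [show (10 : ℝ) / n = 10 * n / n ^ 2 by field_simp, Real.norm_eq_abs,
      le_div_iff₀ (by positivity), ← abs_of_pos (show (0 : ℝ) < (n : ℝ) ^ 2 by positivity),
      ← abs_mul,
      abs_of_pos (show (0 : ℝ) < (n : ℝ) ^ 2 by positivity)]
    refine le_trans (le_of_eq ?_) hb
    congr 1
    rw [pow_add]
    field_simp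
    ring

lemma tendsto_first {x : ℝ} (h1 : 2 / 3 ≤ x) (h2 : x ≤ 1) :
    Tendsto (fun k : ℕ => (blockCount ⌊(2 : ℝ) ^ k / x⌋₊ : ℝ) / (⌊(2 : ℝ) ^ k / x⌋₊ : ℝ) ^ 2)
      atTop (𝓝 (3 / 2 - x / 4 + 7 * x ^ 2 / 48)) := by
  have hx : 0 < x := by linarith
  have h := tendsto_of_quadratic (x := x) (a := 3 / 2) (b := -1) (c := 7 / 3) hx fun t => ?_
  · convert h using 2
    ring
  · have hH : (0 : ℝ) < 2 ^ t := by positivity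
    convert abs_blockCount_sub_le_first t _ ?_ ?_ using 3
    · ring
    · apply Nat.le_floor
      push_cast
      rw [le_div_iff₀ hx, pow_add]
      nlinarith
    · apply Nat.floor_le_of_le
      push_cast
      rw [div_le_iff₀ hx, pow_add]
      nlinarith

lemma tendsto_second {x : ℝ} (h1 : 1 / 2 ≤ x) (h2 : x ≤ 2 / 3) :
    Tendsto (fun k : ℕ => (blockCount ⌊(2 : ℝ) ^ k / x⌋₊ : ℝ) / (⌊(2 : ℝ) ^ k / x⌋₊ : ℝ) ^ 2)
      atTop (𝓝 (5 / 4 + x / 2 - 5 * x ^ 2 / 12)) := by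
  have hx : 0 < x := by linarith
  have h := tendsto_of_quadratic (x := x) (a := 5 / 4) (b := 2) (c := -(20 / 3)) hx fun t => ?_
  · convert h using 2
    ring
  · have hH : (0 : ℝ) < 2 ^ t := by positivity
    convert abs_blockCount_sub_le_second t _ ?_ ?_ using 3
    · ring
    · apply Nat.le_floor
      push_cast
      rw [le_div_iff₀ hx, pow_add]
      nlinarith
    · apply Nat.floor_le_of_le
      push_cast
      rw [div_le_iff₀ hx, pow_add]
      nlinarith

/-- The two quadratic forms lie between `39/28 n²` and `7/5 n²` on their ranges. -/
lemma blockCount_bounds {n : ℕ} (hn : 4 ≤ n) :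
    39 / 28 - 10 / (n : ℝ) ≤ (blockCount n : ℝ) / (n : ℝ) ^ 2 ∧
      (blockCount n : ℝ) / (n : ℝ) ^ 2 ≤ 7 / 5 + 10 / (n : ℝ) := by
  obtain ⟨t, ht1, ht2⟩ : ∃ t, 4 * 2 ^ t ≤ n ∧ n ≤ 8 * 2 ^ t := by
    have hl : 2 ≤ Nat.log 2 n := Nat.le_log_of_pow_le (by norm_num) hn
    refine ⟨Nat.log 2 n - 2, ?_, ?_⟩
    · have := Nat.pow_log_le_self 2 (x := n) (by omega)
      rwa [show Nat.log 2 n = 2 + (Nat.log 2 n - 2) by omega, pow_add] at this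
    · have := (Nat.lt_pow_succ_log_self (b := 2) (by norm_num) n).le
      rwa [show (Nat.log 2 n).succ = 3 + (Nat.log 2 n - 2) by omega, pow_add] at this
  have hn0 : (0 : ℝ) < n := by exact_mod_cast (by omega : 0 < n)
  have ht1' : (4 : ℝ) * 2 ^ t ≤ n := by exact_mod_cast ht1
  have ht2' : (n : ℝ) ≤ 8 * 2 ^ t := by exact_mod_cast ht2
  have hs : (10 : ℝ) / n = 10 * n / n ^ 2 := by field_simp
  have key : 39 / 28 * (n : ℝ) ^ 2 - 10 * n ≤ blockCount n ∧
      (blockCount n : ℝ) ≤ 7 / 5 * (n : ℝ) ^ 2 + 10 * n := by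
    rcases le_total n (6 * 2 ^ t) with h | h
    · have h' : (n : ℝ) ≤ 6 * 2 ^ t := by exact_mod_cast h
      have hb := abs_le.1 (abs_blockCount_sub_le_first t n ht1 h)
      generalize (2 : ℝ) ^ t = H at *
      constructor
      · nlinarith [sq_nonneg (3 * (n : ℝ) - 14 * H)]
      · nlinarith [mul_nonneg (sub_nonneg.2 ht1') (sub_nonneg.2 h')]
    · have h' : 6 * (2 : ℝ) ^ t ≤ n := by exact_mod_cast h
      have hb := abs_le.1 (abs_blockCount_sub_le_second t n h ht2)
      generalize (2 : ℝ) ^ t = H at *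
      constructor
      · nlinarith [mul_nonneg (sub_nonneg.2 ht2') (sub_nonneg.2 h')]
      · nlinarith [sq_nonneg (3 * (n : ℝ) - 20 * H)]
  rw [hs, le_div_iff₀ (by positivity), div_le_iff₀ (by positivity), sub_mul, add_mul,
    div_mul_cancel₀ _ (by positivity)]
  exact key

/-- An eventual upper bound tending to `L`, together with a subsequence tending to `L`, determines
the upper limit. -/
lemma limsup_eq_of_le_of_tendsto {u v : ℕ → ℝ} {φ : ℕ → ℕ} {L : ℝ}
    (h : ∀ᶠ n in atTop, u n ≤ v n)
    (hv : Tendsto v atTop (𝓝 L)) (hφ : Tendsto φ atTop atTop)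
    (hu : Tendsto (fun k => u (φ k)) atTop (𝓝 L)) :
    limsup (fun n => (u n : EReal)) atTop = (L : EReal) := by
  have hv' := (continuous_coe_real_ereal.tendsto L).comp hv
  have hu' := (continuous_coe_real_ereal.tendsto L).comp hu
  apply le_antisymm
  · rw [← hv'.limsup_eq]
    refine limsup_le_limsup ?_
    filter_upwards [h] with n hn
    exact EReal.coe_le_coe hn
  · rw [← hu'.limsup_eq]
    exact limsup_le_limsup_of_le (u := fun n => (u n : EReal)) hφ

lemma liminf_eq_of_le_of_tendsto {u v : ℕ → ℝ} {φ : ℕ → ℕ} {L : ℝ}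
    (h : ∀ᶠ n in atTop, v n ≤ u n)
    (hv : Tendsto v atTop (𝓝 L)) (hφ : Tendsto φ atTop atTop)
    (hu : Tendsto (fun k => u (φ k)) atTop (𝓝 L)) :
    liminf (fun n => (u n : EReal)) atTop = (L : EReal) := by
  have hv' := (continuous_coe_real_ereal.tendsto L).comp hv
  have hu' := (continuous_coe_real_ereal.tendsto L).comp hu
  apply le_antisymm
  · rw [← hu'.liminf_eq]
    exact liminf_le_liminf_of_le (u := fun n => (u n : EReal)) hφ
  · rw [← hv'.liminf_eq]
    refine liminf_le_liminf ?_
    filter_upwards [h] with n hn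
    exact EReal.coe_le_coe hn

theorem mainTheorem9 :
    (∀ x : ℝ, 1 / 2 ≤ x → x ≤ 2 / 3 →
      Tendsto
        (fun k : ℕ =>
          (accessibleBlockCount (1 + X + X ^ 2 : (ZMod 2)[X]) ⌊(2 : ℝ) ^ k / x⌋₊ : ℝ)
            / (⌊(2 : ℝ) ^ k / x⌋₊ : ℝ) ^ 2)
        atTop (𝓝 (5 / 4 + x / 2 - 5 * x ^ 2 / 12))) ∧
    (∀ x : ℝ, 2 / 3 ≤ x → x ≤ 1 →
      Tendsto
        (fun k : ℕ =>
          (accessibleBlockCount (1 + X + X ^ 2 : (ZMod 2)[X]) ⌊(2 : ℝ) ^ k / x⌋₊ : ℝ)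
            / (⌊(2 : ℝ) ^ k / x⌋₊ : ℝ) ^ 2)
        atTop (𝓝 (3 / 2 - x / 4 + 7 * x ^ 2 / 48))) ∧
    limsup
        (fun n : ℕ =>
          (((accessibleBlockCount (1 + X + X ^ 2 : (ZMod 2)[X]) n : ℝ) / (n : ℝ) ^ 2 : ℝ) : EReal))
        atTop = ((7 / 5 : ℝ) : EReal) ∧
    liminf
        (fun n : ℕ =>
          (((accessibleBlockCount (1 + X + X ^ 2 : (ZMod 2)[X]) n : ℝ) / (n : ℝ) ^ 2 : ℝ) : EReal))
        atTop = ((39 / 28 : ℝ) : EReal) := by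
  simp only [accessibleBlockCount_eq]
  have h10 : Tendsto (fun n : ℕ => 10 / (n : ℝ)) atTop (𝓝 0) :=
    tendsto_const_div_atTop_nhds_zero_nat 10
  refine ⟨fun x h1 h2 => tendsto_second h1 h2, fun x h1 h2 => tendsto_first h1 h2, ?_, ?_⟩
  -- the first quadratic in `x` is maximal at `x = 3 / 5`
  · refine limsup_eq_of_le_of_tendsto (v := fun n => 7 / 5 + 10 / (n : ℝ)) ?_ ?_
      (tendsto_pow_div_floor (x := 3 / 5) (by norm_num)).2 ?_
    · filter_upwards [eventually_ge_atTop 4] with n hn using (blockCount_bounds hn).2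
    · simpa using h10.const_add (7 / 5)
    · convert tendsto_second (x := 3 / 5) (by norm_num) (by norm_num) using 2
      norm_num
  -- the second quadratic in `x` is minimal at `x = 6 / 7`
  · refine liminf_eq_of_le_of_tendsto (v := fun n => 39 / 28 - 10 / (n : ℝ)) ?_ ?_
      (tendsto_pow_div_floor (x := 6 / 7) (by norm_num)).2 ?_
    · filter_upwards [eventually_ge_atTop 4] with n hn using (blockCount_bounds hn).1
    · simpa using h10.const_sub (39 / 28)
    · convert tendsto_first (x := 6 / 7) (by norm_num) (by norm_num) using 2
      norm_num
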